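/- A body in $\mathbb R^2$ is a compact convex set with nonempty interior. Let $K,C\subset\mathbb R^2$ be bodies with $C=-C$. Set $$s(K)=\inf\{\rho>0:\ K-c\subset\rho(c-K)\text{ for some }c\in\mathbb R^2\},$$ $$R(K,C)=\inf\{\rho>0:\ K\subset\rho C+t\text{ for some }t\in\mathbb R^2\},\qquad r(K,C)=\sup\{\rho>0:\ \rho C\subset K+t\text{ for some }t\in\mathbb R^2\},$$ $$b_u(K,C)=\frac{\max_{x,y\in K}u^T(x-y)}{\max_{x\in C}u^Tx}\quad(u\neq0),\qquad D(K,C)=\max_{u\ne0}b_u(K,C),\qquad w(K,C)=\min_{u\neq0}b_u(K,C).$$ $K$ is called pseudo-complete with respect to $C$ if $r(K,C)+R(K,C)=D(K,C)$. Theorem. If $K$ is pseudo-complete with respect to $C$, then $$\frac{D(K,C)}{w(K,C)}\le\min\left\{\frac{s(K)+1}{2},\ \frac{s(K)^2}{s(K)^2-1}\right\},$$ where for $s(K)=1$ the second term is read as $+\infty$. Consequently, for every such $K$ and $C$, $$\frac{D(K,C)}{w(K,C)}\le\beta:=\frac16\left(4+\sqrt[3]{19-3\sqrt{33}}+\sqrt[3]{19+3\sqrt{33}}\right)\approx1.42$$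 (precisely, $|\beta-1.42|<0.005$), and $\beta=\frac{\tilde s+1}{2}$, where $\tilde s$ is the unique solution in $(1,\infty)$ of $\frac{s+1}{2}=\frac{s^2}{s^2-1}$. -/

import Mathlib

open scoped Pointwise

/-- `A ⊂ₜ B`: some translate of `B` contains `A`, i.e. `A ⊆ B + t` for some `t`. -/
def SubsetUpToTranslation {E : Type*} [AddCommGroup E] (A B : Set E) : Prop :=
  ∃ t : E, A ⊆ B + {t}

/-- The Minkowski asymmetry
`s(K) = inf {ρ > 0 : K - c ⊆ ρ (c - K) for some c}`. -/
noncomputable def minkowskiAsymmetry {E : Type*} [AddCommGroup E] [Module ℝ E] (K : Set E) : ℝ :=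
  sInf {ρ : ℝ | 0 < ρ ∧ ∃ c : E, K - {c} ⊆ ρ • ({c} - K)}

/-- The circumradius `R(K, C) = inf {ρ > 0 : K ⊂ₜ ρ C}`. -/
noncomputable def circumradius {E : Type*} [AddCommGroup E] [Module ℝ E] (K C : Set E) : ℝ :=
  sInf {ρ : ℝ | 0 < ρ ∧ SubsetUpToTranslation K (ρ • C)}

/-- The inradius `r(K, C) = sup {ρ > 0 : ρ C ⊂ₜ K}`. -/
noncomputable def inradius {E : Type*} [AddCommGroup E] [Module ℝ E] (K C : Set E) : ℝ :=
  sSup {ρ : ℝ | 0 < ρ ∧ SubsetUpToTranslation (ρ • C) K}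

/-- The breadth of `K` with respect to `C` in direction `u`,
`b_u(K, C) = max_{x, y ∈ K} ⟨u, x - y⟩ / max_{x ∈ C} ⟨u, x⟩`. The suprema are maxima when `K` and
`C` are compact and nonempty. -/
noncomputable def breadth {E : Type*} [NormedAddCommGroup E] [InnerProductSpace ℝ E]
    (u : E) (K C : Set E) : ℝ :=
  sSup {a : ℝ | ∃ x ∈ K, ∃ y ∈ K, a = inner ℝ u (x - y)} /
    sSup {a : ℝ | ∃ x ∈ C, a = inner ℝ u x}

/-- The width `w(K, C)`, the minimal breadth of `K` with respect to `C`. The infimum is a minimum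
for convex bodies `K`, `C` with `C` symmetric about the origin. -/
noncomputable def relWidth {E : Type*} [NormedAddCommGroup E] [InnerProductSpace ℝ E]
    (K C : Set E) : ℝ :=
  sInf {b : ℝ | ∃ u : E, u ≠ 0 ∧ b = breadth u K C}

/-- The diameter `D(K, C)`, the maximal breadth of `K` with respect to `C`. The supremum is a
maximum for convex bodies `K`, `C` with `C` symmetric about the origin. -/
noncomputable def relDiameter {E : Type*} [NormedAddCommGroup E] [InnerProductSpace ℝ E]
    (K C : Set E) : ℝ :=
  sSup {b : ℝ | ∃ u : E, u ≠ 0 ∧ b = breadth u K C}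

/-- `K` is pseudo-complete with respect to `C` if `r(K, C) + R(K, C) = D(K, C)`. -/
def IsPseudoComplete {E : Type*} [NormedAddCommGroup E] [InnerProductSpace ℝ E]
    (K C : Set E) : Prop :=
  inradius K C + circumradius K C = relDiameter K C

/-- The constant `(4 + ∛(19 - 3√33) + ∛(19 + 3√33)) / 6`; both radicands are positive. -/
noncomputable def ratioBound : ℝ :=
  1 / 6 * (4 + (19 - 3 * Real.sqrt 33) ^ (1 / 3 : ℝ) + (19 + 3 * Real.sqrt 33) ^ (1 / 3 : ℝ))

/-- A (full-dimensional) convex body: a compact convex set with nonempty interior. -/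
def IsFullConvexBody {E : Type*} [NormedAddCommGroup E] [InnerProductSpace ℝ E]
    (K : Set E) : Prop :=
  Convex ℝ K ∧ IsCompact K ∧ (interior K).Nonempty

/-!
Translate `K` so that the inball `r C` is centred at the origin. Then `r C ⊆ K ⊆ (D - r) C`, and
pseudo-completeness says that `D - r = R`; comparing with `R ≤ s D / (s + 1)` shows that `K` is
Minkowski centred with `D = (s + 1) r`. As `w ≥ 2 r`, this gives `D / w ≤ (s + 1) / 2`.

For the second bound, minimality of `s` puts `0` in the convex hull of the normals of the
hyperplanes supporting both `K` and `-s K`. In the plane, when `s > 1`, it takes three of them, and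
they form a triangle around `K`. Measuring `u` against this triangle gives
`(s² - 1) ⟨u, x⟩ ≤ s max (h_K(u)) (h_K(-u))` for `x ∈ K ∩ -K`. With `x ∈ r C` and
`(s + 1) max (h_K(u)) (h_K(-u)) ≤ s (h_K(u) + h_K(-u))` this is `(s² - 1) D ≤ s² b_u` for all `u`.

The two bounds cross where `β = (s + 1) / 2` satisfies `4 β (β - 1)² = 1`, which Cardano's formula
solves.
-/

section RatioBound

theorem ratioBound_cubic : 4 * ratioBound * (ratioBound - 1) ^ 2 = 1 := by
  have hsq : √33 ^ 2 = 33 := Real.sq_sqrt (by norm_num)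
  have hA : 0 ≤ 19 - 3 * √33 := by
    nlinarith [Real.sqrt_nonneg 33]
  have hB : 0 ≤ 19 + 3 * √33 := by positivity
  have cube_root : ∀ y : ℝ, 0 ≤ y → (y ^ (1 / 3 : ℝ)) ^ 3 = y := fun y hy => by
    rw [← Real.rpow_natCast, ← Real.rpow_mul hy]
    norm_num
  set a : ℝ := (19 - 3 * √33) ^ (1 / 3 : ℝ)
  set b : ℝ := (19 + 3 * √33) ^ (1 / 3 : ℝ)
  have ha3 : a ^ 3 = 19 - 3 * √33 := cube_root _ hA
  have hb3 : b ^ 3 = 19 + 3 * √33 := cube_root _ hB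
  have hab : a * b = 4 := by
    have hab3 : (a * b) ^ 3 = 4 ^ 3 := by
      rw [mul_pow, ha3, hb3]
      linear_combination -9 * hsq
    exact (Odd.strictMono_pow (by decide)).injective hab3
  have hβ : ratioBound = 1 / 6 * (4 + a + b) := rfl
  rw [hβ]
  linear_combination (1 / 54) * ha3 + (1 / 54) * hb3 + (1 / 18) * (a + b) * hab

theorem strictMonoOn_cubic : StrictMonoOn (fun x : ℝ => 4 * x * (x - 1) ^ 2) (Set.Ici 1) := by
  intro x hx y _ hxy
  have hx1 : 1 ≤ x := hx
  have hsq : (x - 1) ^ 2 < (y - 1) ^ 2 := by gcongr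
  exact mul_lt_mul' (by linarith) hsq (sq_nonneg _) (by linarith)

theorem one_lt_ratioBound : 1 < ratioBound := by
  have h : 2 / 3 ≤ ratioBound := by
    have hA : 0 ≤ (19 - 3 * √33) ^ (1 / 3 : ℝ) := by
      apply Real.rpow_nonneg
      nlinarith [Real.sqrt_nonneg 33, Real.sq_sqrt (show (0 : ℝ) ≤ 33 by norm_num)]
    have hB : 0 ≤ (19 + 3 * √33) ^ (1 / 3 : ℝ) := by positivity
    simp only [ratioBound]
    linarith
  by_contra! hle
  nlinarith [ratioBound_cubic]

theorem abs_ratioBound_sub_lt : |ratioBound - 1.42| < 0.005 := by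
  have hβ : ratioBound ∈ Set.Ici 1 := one_lt_ratioBound.le
  have lower : 1.415 < ratioBound := by
    rw [← strictMonoOn_cubic.lt_iff_lt (by norm_num) hβ, ratioBound_cubic]
    norm_num
  have upper : ratioBound < 1.425 := by
    rw [← strictMonoOn_cubic.lt_iff_lt hβ (by norm_num), ratioBound_cubic]
    norm_num
  rw [abs_lt]
  constructor <;> linarith

theorem half_add_one_eq_sq_div_iff {s : ℝ} (hs : 1 < s) :
    (s + 1) / 2 = s ^ 2 / (s ^ 2 - 1) ↔ ratioBound = (s + 1) / 2 := by
  have hden : s ^ 2 - 1 ≠ 0 := by nlinarith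
  have hmem : (s + 1) / 2 ∈ Set.Ici (1 : ℝ) := by rw [Set.mem_Ici]; linarith
  rw [← strictMonoOn_cubic.injOn.eq_iff one_lt_ratioBound.le hmem, ratioBound_cubic,
    eq_div_iff hden]
  constructor <;> intro h <;> linear_combination -h

theorem le_ratioBound {s q : ℝ} (hs : 1 ≤ s) (h₁ : q ≤ (s + 1) / 2)
    (h₂ : s ≠ 1 → q ≤ s ^ 2 / (s ^ 2 - 1)) : q ≤ ratioBound := by
  rcases le_or_gt q 1 with hq | hq
  · exact hq.trans one_lt_ratioBound.le
  have hqs : 2 * q - 1 ≤ s := by linarith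
  have hs1 : 1 < s := by linarith
  have hden : 0 < s ^ 2 - 1 := by nlinarith
  have hprod : (q - 1) * (s ^ 2 - 1) ≤ 1 := by
    linarith [(le_div_iff₀ hden).1 (h₂ hs1.ne')]
  rw [← strictMonoOn_cubic.le_iff_le hq.le one_lt_ratioBound.le, ratioBound_cubic]
  calc 4 * q * (q - 1) ^ 2 = (q - 1) * ((2 * q - 1) ^ 2 - 1) := by ring
    _ ≤ (q - 1) * (s ^ 2 - 1) := by gcongr; linarith
    _ ≤ 1 := hprod

end RatioBound

section Compactness

theorem isCompact_sub {G : Type*} [AddGroup G] [TopologicalSpace G] [IsTopologicalAddGroup G]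
    {A B : Set G} (hA : IsCompact A) (hB : IsCompact B) : IsCompact (A - B) :=
  sub_eq_add_neg A B ▸ hA.add hB.neg

theorem isCompact_convexHull {E : Type*} [NormedAddCommGroup E] [NormedSpace ℝ E]
    [FiniteDimensional ℝ E] {s : Set E} (hs : IsCompact s) : IsCompact (convexHull ℝ s) := by
  set n := Module.finrank ℝ E + 1
  let comb : (Fin n → ℝ) × (Fin n → E) → E := fun p => ∑ i, p.1 i • p.2 i
  suffices h : convexHull ℝ s = comb '' (stdSimplex ℝ (Fin n) ×ˢ Set.univ.pi fun _ => s) by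
    rw [h]
    exact ((isCompact_stdSimplex ℝ (Fin n)).prod (isCompact_univ_pi fun _ => hs)).image
      (by fun_prop)
  refine Set.Subset.antisymm (fun x hx => ?_) ?_
  · obtain ⟨ι, _, z, w, hz, hind, hw, hw1, rfl⟩ := eq_pos_convex_span_of_mem_convexHull hx
    have : Nonempty ι := by
      by_contra h
      rw [not_nonempty_iff] at h
      simp at hw1
    obtain ⟨e⟩ : Nonempty (ι ↪ Fin n) := Function.Embedding.nonempty_of_card_le <| by
      rw [Fintype.card_fin]
      exact hind.card_le_finrank_succ.trans (Nat.succ_le_succ (Submodule.finrank_le _))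
    let w' : Fin n → ℝ := Function.extend e w 0
    have hwe : ∀ i, w' (e i) = w i := e.injective.extend_apply w 0
    have hw0 : ∀ j ∉ Set.range e, w' j = 0 := fun j hj => Function.extend_apply' w _ j hj
    refine ⟨(w', z ∘ Function.invFun e), ⟨⟨fun j => ?_, ?_⟩, ?_⟩, ?_⟩
    · by_cases hj : j ∈ Set.range e
      · obtain ⟨i, rfl⟩ := hj
        exact (hw i).le.trans_eq (hwe i).symm
      · exact (hw0 j hj).ge
    · rw [← hw1]
      exact (Fintype.sum_of_injective e e.injective _ _ hw0 fun i => (hwe i).symm).symm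
    · exact fun j _ => hz ⟨_, rfl⟩
    · refine (Fintype.sum_of_injective e e.injective _ _ (fun j hj => ?_) fun i => ?_).symm
      · simp only [hw0 j hj, zero_smul]
      · simp only [hwe, Function.comp_apply, Function.leftInverse_invFun e.injective i]
  · rintro _ ⟨⟨w, z⟩, ⟨⟨hw, hw1⟩, hz⟩, rfl⟩
    exact mem_convexHull_of_exists_fintype w z hw hw1 (fun i => hz i trivial) rfl

theorem exists_pos_forall_add_mul_pos {X : Type*} [TopologicalSpace X] {S : Set X}
    (hS : IsCompact S) {g l : X → ℝ} (hg : Continuous g) (hl : Continuous l)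
    (hg0 : ∀ x, 0 ≤ g x) (hgl : ∀ x ∈ S, g x = 0 → 0 < l x) :
    ∃ ε > 0, ∀ x ∈ S, 0 < g x + ε * l x := by
  have near_zero : ∀ᶠ ε : ℝ in nhds 0, ∀ x ∈ S, 0 < ε → 0 < g x + ε * l x := by
    refine hS.eventually_forall_of_forall_eventually fun x hx => ?_
    rcases (hg0 x).eq_or_lt' with hgx | hgx
    · have hlz : ∀ᶠ z : ℝ × X in nhds (0, x), 0 < l z.2 :=
        (hl.comp continuous_snd).continuousAt.eventually_const_lt (hgl x hx hgx)
      exact hlz.mono fun z hz hε => add_pos_of_nonneg_of_pos (hg0 z.2) (mul_pos hε hz)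
    · have hcont : Continuous fun z : ℝ × X => g z.2 + z.1 * l z.2 := by fun_prop
      exact (hcont.continuousAt.eventually_const_lt (by simpa using hgx)).mono fun z hz _ => hz
  obtain ⟨ε, hε, hpos⟩ :=
    ((eventually_mem_nhdsWithin (a := (0 : ℝ)) (s := Set.Ioi 0)).and
      (near_zero.filter_mono nhdsWithin_le_nhds)).exists
  exact ⟨ε, hε, fun x hx => hpos x hx hε⟩

end Compactness

section Triangle

variable {E : Type*}

theorem add_mul_sq_sub_one_le {s l₁ l₂ l₃ P₁₂ P₂₁ α β M : ℝ} (hs : 1 ≤ s)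
    (hl₁ : 0 < l₁) (hl₂ : 0 < l₂) (hl₃ : 0 < l₃)
    (h₁ : s * l₁ ≤ l₂ + l₃) (h₂ : s * l₂ ≤ l₁ + l₃) (h₃ : s * l₃ ≤ l₁ + l₂)
    (hP₁₂ : l₂ * P₁₂ ≤ l₃ - s * l₁) (hP₂₁ : l₁ * P₂₁ ≤ l₃ - s * l₂)
    (hα : 0 ≤ α) (hβ : 0 ≤ β) (hM₁ : α * s - β * P₁₂ ≤ M) (hM₂ : β * s - α * P₂₁ ≤ M) :
    (α + β) * (s ^ 2 - 1) ≤ s * M := by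
  -- The weights `d₁` and `d₂` of the two bounds below make the coefficients of `α` and `β` equal.
  set d₁ := s * l₁ + l₃ - s * l₂
  set d₂ := s * l₂ + l₃ - s * l₁
  set N := l₃ * (s * (l₁ + l₂) - l₃)
  set T := l₂ * d₁ + l₁ * d₂
  have hd₁0 : 0 ≤ d₁ := by nlinarith
  have hd₂0 : 0 ≤ d₂ := by nlinarith
  have hT0 : 0 < T := by
    rcases hd₁0.eq_or_lt with h | h
    · have : 0 < d₂ := by linarith
      positivity
    · positivity
  have bound₁ : α * (s * l₂) - β * (l₃ - s * l₁) ≤ M * l₂ := by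
    nlinarith [mul_le_mul_of_nonneg_left hP₁₂ hβ, mul_le_mul_of_nonneg_right hM₁ hl₂.le]
  have bound₂ : β * (s * l₁) - α * (l₃ - s * l₂) ≤ M * l₁ := by
    nlinarith [mul_le_mul_of_nonneg_left hP₂₁ hα, mul_le_mul_of_nonneg_right hM₂ hl₁.le]
  have combined : (α + β) * N ≤ M * T := by
    linear_combination d₁ * bound₁ + d₂ * bound₂
  have hTN : (s ^ 2 - 1) * T ≤ s * N := by
    have h : 0 ≤ l₃ * (l₁ + l₂ - s * l₃) + s * (s ^ 2 - 1) * (l₁ - l₂) ^ 2 := by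
      have : 0 ≤ s ^ 2 - 1 := by nlinarith
      have : 0 ≤ l₁ + l₂ - s * l₃ := by linarith
      positivity
    linear_combination h
  refine le_of_mul_le_mul_right ?_ hT0
  calc (α + β) * (s ^ 2 - 1) * T = (α + β) * ((s ^ 2 - 1) * T) := by ring
    _ ≤ (α + β) * (s * N) := by gcongr
    _ = s * ((α + β) * N) := by ring
    _ ≤ s * (M * T) := by gcongr
    _ = s * M * T := by ring

theorem exists_perm_sum_smul_eq_sub [AddCommGroup E] [Module ℝ E] {b : Fin 3 → E} {w : Fin 3 → ℝ}
    (hw : ∀ i, 0 < w i) (hb : ∑ i, w i • b i = 0) (μ : Fin 3 → ℝ) :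
    ∃ (σ : Equiv.Perm (Fin 3)) (α β : ℝ), 0 ≤ α ∧ 0 ≤ β ∧
      ∑ i, μ i • b i = α • b (σ 2) - β • b (σ 0) := by
  set f : Fin 3 → ℝ := fun i => μ i / w i
  set σ := Tuple.sort f
  have hmono : Monotone (f ∘ σ) := Tuple.monotone_sort f
  have hlow : 0 ≤ f (σ 1) - f (σ 0) := sub_nonneg.2 (hmono (by decide))
  have hhigh : 0 ≤ f (σ 2) - f (σ 1) := sub_nonneg.2 (hmono (by decide))
  have hμ : ∀ i, μ i = w i * f i := fun i => (mul_div_cancel₀ _ (hw i).ne').symm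
  refine ⟨σ, _, _, mul_nonneg (hw (σ 2)).le hhigh, mul_nonneg (hw (σ 0)).le hlow, ?_⟩
  rw [← Equiv.sum_comp σ, Fin.sum_univ_three] at hb ⊢
  simp only [hμ]
  linear_combination (norm := module) f (σ 1) • hb

end Triangle

variable {E : Type*} [NormedAddCommGroup E] [InnerProductSpace ℝ E] {A B C K : Set E} {u : E}

section SupportFunction

/-- The support function `h_K(u) = max_{x ∈ K} ⟨u, x⟩` of a compact nonempty set `K`; it turns
inclusions between convex bodies into pointwise inequalities. -/
noncomputable def supportFun (K : Set E) (u : E) : ℝ :=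
  sSup ((fun x => inner ℝ u x) '' K)

theorem bddAbove_inner_image (hK : IsCompact K) (u : E) :
    BddAbove ((fun x => inner ℝ u x) '' K) :=
  hK.bddAbove_image (by fun_prop)

theorem inner_le_supportFun (hK : IsCompact K) (u : E) {x : E} (hx : x ∈ K) :
    inner ℝ u x ≤ supportFun K u :=
  le_csSup (bddAbove_inner_image hK u) ⟨x, hx, rfl⟩

theorem supportFun_le (hK : K.Nonempty) {a : ℝ} (h : ∀ x ∈ K, inner ℝ u x ≤ a) :
    supportFun K u ≤ a :=
  csSup_le (hK.image _) (Set.forall_mem_image.2 h)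

theorem exists_inner_eq_supportFun (hK : IsCompact K) (hne : K.Nonempty) (u : E) :
    ∃ x ∈ K, inner ℝ u x = supportFun K u := by
  obtain ⟨x, hx, h⟩ := hK.exists_sSup_image_eq hne (f := fun x => inner ℝ u x) (by fun_prop)
  exact ⟨x, hx, h.symm⟩

theorem continuous_supportFun (hK : IsCompact K) : Continuous (supportFun K) :=
  hK.continuous_sSup (f := fun u x => inner ℝ u x) (by fun_prop)

theorem supportFun_mono (hA : A.Nonempty) (hB : IsCompact B) (hAB : A ⊆ B) (u : E) :
    supportFun A u ≤ supportFun B u :=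
  supportFun_le hA fun _ hx => inner_le_supportFun hB u (hAB hx)

theorem supportFun_singleton (c u : E) : supportFun {c} u = inner ℝ u c := by
  rw [supportFun, Set.image_singleton, csSup_singleton]

theorem supportFun_neg_set (K : Set E) (u : E) : supportFun (-K) u = supportFun K (-u) := by
  simp only [supportFun, ← Set.image_neg_eq_neg, Set.image_image, inner_neg_right, inner_neg_left]

theorem supportFun_smul_set {c : ℝ} (hc : 0 ≤ c) (K : Set E) (u : E) :
    supportFun (c • K) u = c * supportFun K u := by
  rw [supportFun, supportFun, ← smul_eq_mul, ← Real.sSup_smul_of_nonneg hc, ← Set.image_smul,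
    ← Set.image_smul, Set.image_image, Set.image_image]
  simp only [real_inner_smul_right, smul_eq_mul]

theorem supportFun_smul {c : ℝ} (hc : 0 ≤ c) (K : Set E) (u : E) :
    supportFun K (c • u) = c * supportFun K u := by
  rw [← supportFun_smul_set hc, supportFun, supportFun, ← Set.image_smul, Set.image_image]
  simp only [real_inner_smul_left, real_inner_smul_right]

theorem supportFun_zero (K : Set E) : supportFun K 0 = 0 := by
  rw [← zero_smul ℝ (0 : E), supportFun_smul le_rfl, zero_mul]

theorem supportFun_add_set (hA : IsCompact A) (hA0 : A.Nonempty) (hB : IsCompact B)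
    (hB0 : B.Nonempty) (u : E) : supportFun (A + B) u = supportFun A u + supportFun B u := by
  have h : (innerSL ℝ u '' (A + B)) = innerSL ℝ u '' A + innerSL ℝ u '' B := Set.image_add _
  exact (congrArg sSup h).trans <| csSup_add (hA0.image _) (bddAbove_inner_image hA u)
    (hB0.image _) (bddAbove_inner_image hB u)

theorem supportFun_sub_set (hA : IsCompact A) (hA0 : A.Nonempty) (hB : IsCompact B)
    (hB0 : B.Nonempty) (u : E) : supportFun (A - B) u = supportFun A u + supportFun B (-u) := by
  rw [sub_eq_add_neg, supportFun_add_set hA hA0 hB.neg hB0.neg, supportFun_neg_set]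

theorem subset_iff_supportFun_le [CompleteSpace E] (hA : IsCompact A) (hA0 : A.Nonempty)
    (hB : IsCompact B) (hB0 : B.Nonempty) (hBconv : Convex ℝ B) :
    A ⊆ B ↔ ∀ u, supportFun A u ≤ supportFun B u := by
  refine ⟨supportFun_mono hA0 hB, fun h x hx => ?_⟩
  by_contra hxB
  obtain ⟨f, a, hfB, hfx⟩ := geometric_hahn_banach_closed_point hBconv hB.isClosed hxB
  set u := (InnerProductSpace.toDual ℝ E).symm f
  have hf : ∀ y, inner ℝ u y = f y := fun y => InnerProductSpace.toDual_symm_apply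
  refine absurd (h u) (not_le.2 ?_)
  calc supportFun B u ≤ a := supportFun_le hB0 fun y hy => (hf y).trans_le (hfB y hy).le
    _ < inner ℝ u x := hfx.trans_eq (hf x).symm
    _ ≤ supportFun A u := inner_le_supportFun hA u hx

theorem sub_singleton_subset_smul_iff [CompleteSpace E] (hK : IsCompact K) (hK0 : K.Nonempty)
    (hconv : Convex ℝ K) {ρ : ℝ} (hρ : 0 ≤ ρ) (c : E) :
    K - {c} ⊆ ρ • ({c} - K) ↔
      ∀ u, supportFun K u - inner ℝ u c ≤ ρ * (inner ℝ u c + supportFun K (-u)) := by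
  have hc : IsCompact ({c} : Set E) := isCompact_singleton
  have hc0 : ({c} : Set E).Nonempty := Set.singleton_nonempty c
  rw [subset_iff_supportFun_le (isCompact_sub hK hc) (hK0.sub hc0) ((isCompact_sub hc hK).smul ρ)
    (hc0.sub hK0).smul_set (((convex_singleton c).sub hconv).smul ρ)]
  refine forall_congr' fun u => ?_
  rw [supportFun_smul_set hρ, supportFun_sub_set hK hK0 hc hc0, supportFun_sub_set hc hc0 hK hK0,
    supportFun_singleton, supportFun_singleton, inner_neg_left, sub_eq_add_neg]

theorem breadth_eq_supportFun_div (u : E) (K C : Set E) :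
    breadth u K C = supportFun (K - K) u / supportFun C u := by
  have hKK : {a : ℝ | ∃ x ∈ K, ∃ y ∈ K, a = inner ℝ u (x - y)} =
      (fun x => inner ℝ u x) '' (K - K) := by
    ext a
    simp [Set.mem_sub, eq_comm, and_assoc]
  have hC : {a : ℝ | ∃ x ∈ C, a = inner ℝ u x} = (fun x => inner ℝ u x) '' C := by
    ext a
    simp [eq_comm]
  rw [breadth, hKK, hC, supportFun, supportFun]

end SupportFunction

section Translation

theorem breadth_add_singleton (u : E) (K C : Set E) (t : E) :
    breadth u (K + {t}) C = breadth u K C := by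
  rw [breadth_eq_supportFun_div, breadth_eq_supportFun_div, add_sub_add_comm]
  simp

theorem relDiameter_add_singleton (K C : Set E) (t : E) :
    relDiameter (K + {t}) C = relDiameter K C := by
  simp only [relDiameter, breadth_add_singleton]

theorem relWidth_add_singleton (K C : Set E) (t : E) :
    relWidth (K + {t}) C = relWidth K C := by
  simp only [relWidth, breadth_add_singleton]

theorem add_singleton_subset_iff {V : Type*} [AddCommGroup V] {A B : Set V} {t : V} :
    A + {t} ⊆ B ↔ A ⊆ B + {-t} := by
  rw [Set.add_singleton, Set.image_subset_iff, Set.add_singleton, Set.image_add_right, neg_neg]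

theorem inradius_add_singleton {V : Type*} [AddCommGroup V] [Module ℝ V] (K C : Set V) (t : V) :
    inradius (K + {t}) C = inradius K C := by
  have h : ∀ A : Set V, SubsetUpToTranslation A (K + {t}) ↔ SubsetUpToTranslation A K := fun A =>
    (Equiv.addLeft t).exists_congr fun t' => by
      rw [add_assoc, Set.singleton_add_singleton]; rfl
  simp only [inradius, h]

theorem circumradius_add_singleton {V : Type*} [AddCommGroup V] [Module ℝ V] (K C : Set V)
    (t : V) : circumradius (K + {t}) C = circumradius K C := by
  have h : ∀ B : Set V, SubsetUpToTranslation (K + {t}) B ↔ SubsetUpToTranslation K B := fun B =>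
    (Equiv.subRight t).exists_congr fun t' => by
      rw [add_singleton_subset_iff, add_assoc, Set.singleton_add_singleton, ← sub_eq_add_neg]; rfl
  simp only [circumradius, h]

theorem minkowskiAsymmetry_add_singleton {V : Type*} [AddCommGroup V] [Module ℝ V] (K : Set V)
    (t : V) : minkowskiAsymmetry (K + {t}) = minkowskiAsymmetry K := by
  have h : ∀ ρ : ℝ, (∃ c, K + {t} - {c} ⊆ ρ • ({c} - (K + {t}))) ↔
      ∃ c, K - {c} ⊆ ρ • ({c} - K) := fun ρ =>
    ((Equiv.addRight t).exists_congr fun c => by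
      rw [Equiv.coe_addRight, ← Set.singleton_add_singleton, add_sub_add_comm, add_sub_add_comm]
      simp).symm
  simp only [minkowskiAsymmetry, h]

theorem isPseudoComplete_add_singleton_iff (t : E) :
    IsPseudoComplete (K + {t}) C ↔ IsPseudoComplete K C := by
  simp only [IsPseudoComplete, inradius_add_singleton, circumradius_add_singleton,
    relDiameter_add_singleton]

end Translation

section Bodies

theorem exists_pos_subset_smul {V : Type*} [NormedAddCommGroup V] [NormedSpace ℝ V] {A B : Set V}
    (hA : Bornology.IsBounded A) (hB : 0 ∈ interior B) : ∃ ρ : ℝ, 0 < ρ ∧ A ⊆ ρ • B := by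
  have hvN : Bornology.IsVonNBounded ℝ A := (NormedSpace.isVonNBounded_iff ℝ).2 hA
  obtain ⟨ρ, hρ, h⟩ := (hvN (mem_interior_iff_mem_nhds.1 hB)).exists_pos
  exact ⟨ρ, hρ, h ρ (le_abs_self ρ)⟩

theorem exists_pos_norm_le_mul_supportFun (hK : IsCompact K) (h0 : 0 ∈ interior K) :
    ∃ ρ > 0, ∀ u, ‖u‖ ≤ ρ * supportFun K u := by
  obtain ⟨ρ, hρ, hball⟩ :=
    exists_pos_subset_smul (Metric.isBounded_closedBall (x := (0 : E)) (r := 1)) h0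
  refine ⟨ρ, hρ, fun u => ?_⟩
  have hu : ‖u‖⁻¹ • u ∈ ρ • K := hball <| by
    rw [mem_closedBall_zero_iff, norm_smul, norm_inv, norm_norm]
    exact inv_mul_le_one
  calc ‖u‖ = inner ℝ u (‖u‖⁻¹ • u) := by
        rw [real_inner_smul_right, real_inner_self_eq_norm_mul_norm, ← mul_assoc,
          inv_mul_mul_self]
    _ ≤ supportFun (ρ • K) u := inner_le_supportFun (hK.smul ρ) u hu
    _ = ρ * supportFun K u := supportFun_smul_set hρ.le K u

theorem supportFun_pos (hK : IsCompact K) (h0 : 0 ∈ interior K) (hu : u ≠ 0) :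
    0 < supportFun K u := by
  obtain ⟨ρ, hρ, h⟩ := exists_pos_norm_le_mul_supportFun hK h0
  exact pos_of_mul_pos_right ((norm_pos_iff.2 hu).trans_le (h u)) hρ.le

namespace IsFullConvexBody

theorem convex (hK : IsFullConvexBody K) : Convex ℝ K := hK.1

theorem isCompact (hK : IsFullConvexBody K) : IsCompact K := hK.2.1

theorem nonempty (hK : IsFullConvexBody K) : K.Nonempty := hK.2.2.mono interior_subset

theorem finiteDimensional (hK : IsFullConvexBody K) : FiniteDimensional ℝ E := by
  obtain ⟨x, hx⟩ := hK.2.2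
  obtain ⟨ε, hε, hball⟩ := Metric.nhds_basis_closedBall.mem_iff.1 (mem_interior_iff_mem_nhds.1 hx)
  exact .of_isCompact_closedBall ℝ hε
    (hK.isCompact.of_isClosed_subset Metric.isClosed_closedBall hball)

theorem add_singleton (hK : IsFullConvexBody K) (t : E) : IsFullConvexBody (K + {t}) :=
  ⟨hK.convex.add (convex_singleton t), hK.isCompact.add isCompact_singleton,
    (hK.2.2.add (Set.singleton_nonempty t)).mono subset_interior_add_left⟩

theorem zero_mem_interior (hC : IsFullConvexBody C) (hsymm : -C = C) : 0 ∈ interior C := by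
  obtain ⟨x, hx⟩ := hC.2.2
  have hx' : -x ∈ interior C := by
    rw [← hsymm, ← Set.image_neg_eq_neg]
    exact (Homeomorph.neg E).image_interior C ▸ ⟨x, hx, rfl⟩
  simpa only [midpoint_self_neg] using hC.convex.interior.midpoint_mem hx hx'

end IsFullConvexBody

theorem supportFun_neg_of_neg_eq (hC : -C = C) (u : E) : supportFun C (-u) = supportFun C u := by
  rw [← supportFun_neg_set, hC]

theorem breadth_mul_supportFun (hK : IsFullConvexBody K) (hC : IsFullConvexBody C)
    (hsymm : -C = C) (hu : u ≠ 0) :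
    breadth u K C * supportFun C u = supportFun K u + supportFun K (-u) := by
  rw [breadth_eq_supportFun_div, supportFun_sub_set hK.isCompact hK.nonempty hK.isCompact
    hK.nonempty, div_mul_cancel₀]
  exact (supportFun_pos hC.isCompact (hC.zero_mem_interior hsymm) hu).ne'

theorem two_mul_le_breadth (hK : IsFullConvexBody K) (hC : IsFullConvexBody C) (hsymm : -C = C)
    (hu : u ≠ 0) {ρ : ℝ} (hρ : 0 ≤ ρ) (h : ρ • C ⊆ K) : 2 * ρ ≤ breadth u K C := by
  refine le_of_mul_le_mul_right ?_
    (supportFun_pos hC.isCompact (hC.zero_mem_interior hsymm) hu)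
  have hle : ∀ v, ρ * supportFun C v ≤ supportFun K v := fun v =>
    (supportFun_smul_set hρ C v).symm.trans_le
      (supportFun_mono hC.nonempty.smul_set hK.isCompact h v)
  have hle_neg := hle (-u)
  rw [supportFun_neg_of_neg_eq hsymm] at hle_neg
  rw [breadth_mul_supportFun hK hC hsymm hu]
  linarith [hle u]

theorem le_relWidth [Nontrivial E] {a : ℝ} (h : ∀ u : E, u ≠ 0 → a ≤ breadth u K C) :
    a ≤ relWidth K C := by
  obtain ⟨u, hu⟩ := exists_ne (0 : E)
  refine le_csInf ⟨_, u, hu, rfl⟩ ?_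
  rintro _ ⟨v, hv, rfl⟩
  exact h v hv

theorem bddAbove_breadth (hK : IsFullConvexBody K) (hC : IsFullConvexBody C) (hsymm : -C = C) :
    BddAbove {b : ℝ | ∃ u : E, u ≠ 0 ∧ b = breadth u K C} := by
  have hKK := isCompact_sub hK.isCompact hK.isCompact
  have h0 := hC.zero_mem_interior hsymm
  obtain ⟨ρ, hρ, h⟩ := exists_pos_subset_smul hKK.isBounded h0
  refine ⟨ρ, ?_⟩
  rintro _ ⟨u, hu, rfl⟩
  rw [breadth_eq_supportFun_div, div_le_iff₀ (supportFun_pos hC.isCompact h0 hu),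
    ← supportFun_smul_set hρ.le]
  exact supportFun_mono (hK.nonempty.sub hK.nonempty) (hC.isCompact.smul ρ) h u

theorem breadth_le_relDiameter (hK : IsFullConvexBody K) (hC : IsFullConvexBody C)
    (hsymm : -C = C) (hu : u ≠ 0) : breadth u K C ≤ relDiameter K C :=
  le_csSup (bddAbove_breadth hK hC hsymm) ⟨u, hu, rfl⟩

theorem supportFun_add_supportFun_neg_le (hK : IsFullConvexBody K) (hC : IsFullConvexBody C)
    (hsymm : -C = C) (u : E) :
    supportFun K u + supportFun K (-u) ≤ relDiameter K C * supportFun C u := by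
  rcases eq_or_ne u 0 with rfl | hu
  · simp only [neg_zero, supportFun_zero, add_zero, mul_zero, le_refl]
  · rw [← breadth_mul_supportFun hK hC hsymm hu]
    have := supportFun_pos hC.isCompact (hC.zero_mem_interior hsymm) hu
    gcongr
    exact breadth_le_relDiameter hK hC hsymm hu

theorem two_mul_le_relDiameter [Nontrivial E] (hK : IsFullConvexBody K) (hC : IsFullConvexBody C)
    (hsymm : -C = C) {ρ : ℝ} (hρ : 0 ≤ ρ) (h : ρ • C ⊆ K) : 2 * ρ ≤ relDiameter K C := by
  obtain ⟨u, hu⟩ := exists_ne (0 : E)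
  exact (two_mul_le_breadth hK hC hsymm hu hρ h).trans (breadth_le_relDiameter hK hC hsymm hu)

end Bodies

section Radii

theorem isClosed_setOf_smul_subset {V : Type*} [NormedAddCommGroup V] [NormedSpace ℝ V]
    {K : Set V} (hK : IsClosed K) (C : Set V) :
    IsClosed {p : ℝ × V | p.1 • C ⊆ K + {p.2}} := by
  have h : {p : ℝ × V | p.1 • C ⊆ K + {p.2}} = ⋂ x ∈ C, {p | p.1 • x - p.2 ∈ K} := by
    ext p
    simp [Set.smul_set_subset_iff, Set.add_singleton, sub_eq_add_neg]
  rw [h]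
  exact isClosed_biInter fun x _ => hK.preimage (by fun_prop)

theorem exists_pos_smul_subset (hK : IsFullConvexBody K) (hC : IsCompact C) :
    ∃ ρ : ℝ, 0 < ρ ∧ SubsetUpToTranslation (ρ • C) K := by
  obtain ⟨y, hy⟩ := hK.2.2
  have h0 : 0 ∈ interior (K + {-y}) :=
    subset_interior_add_left ⟨y, hy, -y, rfl, add_neg_cancel y⟩
  obtain ⟨ρ, hρ, h⟩ := exists_pos_subset_smul hC.isBounded h0
  exact ⟨ρ⁻¹, inv_pos.2 hρ, -y, (Set.subset_smul_set_iff₀ hρ.ne').1 h⟩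

theorem isGreatest_inradius [Nontrivial E] (hK : IsFullConvexBody K)
    (hC : IsFullConvexBody C) (hsymm : -C = C) :
    IsGreatest {ρ : ℝ | 0 < ρ ∧ SubsetUpToTranslation (ρ • C) K} (inradius K C) := by
  set T : Set (ℝ × E) := {p | 0 ≤ p.1} ∩ {p | p.1 • C ⊆ K + {p.2}}
  have hTclosed : IsClosed T := (isClosed_le continuous_const continuous_fst).inter
    (isClosed_setOf_smul_subset hK.isCompact.isClosed C)
  have hTsub : T ⊆ Set.Icc 0 (relDiameter K C / 2) ×ˢ (-K) := by
    rintro ⟨ρ, t⟩ ⟨hρ, h⟩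
    have hdiam := two_mul_le_relDiameter (hK.add_singleton t) hC hsymm hρ h
    rw [relDiameter_add_singleton] at hdiam
    have h0 : (0 : E) ∈ K + {t} :=
      h ⟨0, interior_subset (hC.zero_mem_interior hsymm), smul_zero ρ⟩
    exact ⟨⟨hρ, by linarith⟩, by simpa [Set.add_singleton] using h0⟩
  have hTcompact : IsCompact T :=
    (isCompact_Icc.prod hK.isCompact.neg).of_isClosed_subset hTclosed hTsub
  obtain ⟨ρ₀, hρ₀, t₀, ht₀⟩ := exists_pos_smul_subset hK hC.isCompact
  obtain ⟨⟨r, t⟩, ⟨-, hrt⟩, hmax⟩ :=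
    hTcompact.exists_isMaxOn ⟨(ρ₀, t₀), hρ₀.le, ht₀⟩ continuous_fst.continuousOn
  have hle {ρ : ℝ} {t' : E} (hρ : 0 < ρ) (h : ρ • C ⊆ K + {t'}) : ρ ≤ r :=
    isMaxOn_iff.1 hmax (ρ, t') ⟨hρ.le, h⟩
  have hr : IsGreatest {ρ : ℝ | 0 < ρ ∧ SubsetUpToTranslation (ρ • C) K} r :=
    ⟨⟨hρ₀.trans_le (hle hρ₀ ht₀), t, hrt⟩, fun _ ⟨hρ, _, ht'⟩ => hle hρ ht'⟩
  rwa [inradius, hr.csSup_eq]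

theorem circumradius_le {V : Type*} [AddCommGroup V] [Module ℝ V] {K C : Set V} {ρ : ℝ}
    (hρ : 0 < ρ) (h : SubsetUpToTranslation K (ρ • C)) : circumradius K C ≤ ρ :=
  csInf_le ⟨0, fun _ hx => hx.1.le⟩ ⟨hρ, h⟩

theorem minkowskiAsymmetry_le {V : Type*} [AddCommGroup V] [Module ℝ V] {K : Set V} {ρ : ℝ}
    {c : V} (hρ : 0 < ρ) (h : K - {c} ⊆ ρ • ({c} - K)) : minkowskiAsymmetry K ≤ ρ :=
  csInf_le ⟨0, fun _ hx => hx.1.le⟩ ⟨hρ, c, h⟩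

theorem circumradius_mul_add_one_le [CompleteSpace E] (hK : IsFullConvexBody K)
    (hC : IsFullConvexBody C) (hsymm : -C = C) (hD : 0 < relDiameter K C) {ρ : ℝ} (hρ : 0 < ρ)
    {c : E} (hc : K - {c} ⊆ ρ • ({c} - K)) :
    circumradius K C * (ρ + 1) ≤ ρ * relDiameter K C := by
  rw [← le_div_iff₀ (by positivity)]
  have hR : 0 < ρ * relDiameter K C / (ρ + 1) := by positivity
  refine circumradius_le hR ⟨c, ?_⟩
  rw [subset_iff_supportFun_le hK.isCompact hK.nonempty
    ((hC.isCompact.smul _).add isCompact_singleton)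
    (hC.nonempty.smul_set.add (Set.singleton_nonempty c))
    ((hC.convex.smul _).add (convex_singleton c))]
  intro u
  have hu := (sub_singleton_subset_smul_iff hK.isCompact hK.nonempty hK.convex hρ.le c).1 hc u
  have hDu := supportFun_add_supportFun_neg_le hK hC hsymm u
  rw [supportFun_add_set (hC.isCompact.smul _) hC.nonempty.smul_set isCompact_singleton
    (Set.singleton_nonempty c), supportFun_smul_set hR.le, supportFun_singleton,
    ← sub_le_iff_le_add, div_mul_eq_mul_div, le_div_iff₀ (by positivity)]
  nlinarith [mul_le_mul_of_nonneg_left hDu hρ.le]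

end Radii

section Centring

/-- `K` is Minkowski centred: the infimum defining `minkowskiAsymmetry K` is attained at the centre
`c = 0`. -/
def IsMinkowskiCentred {V : Type*} [AddCommGroup V] [Module ℝ V] (K : Set V) : Prop :=
  K ⊆ (-minkowskiAsymmetry K) • K

theorem IsMinkowskiCentred.supportFun_le (hcent : IsMinkowskiCentred K) (hK : IsCompact K)
    (hne : K.Nonempty) (u : E) : supportFun K u ≤ minkowskiAsymmetry K * supportFun K (-u) := by
  have hs : 0 ≤ minkowskiAsymmetry K := Real.sInf_nonneg fun _ hx => hx.1.le
  rw [← supportFun_neg_set, ← supportFun_smul_set hs, Set.smul_set_neg, ← Set.neg_smul_set]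
  exact supportFun_mono hne (hK.smul _) hcent u

theorem IsMinkowskiCentred.one_le [Nontrivial E] (hcent : IsMinkowskiCentred K) (hK : IsCompact K)
    (h0 : 0 ∈ interior K) : 1 ≤ minkowskiAsymmetry K := by
  obtain ⟨u, hu⟩ := exists_ne (0 : E)
  have hne : K.Nonempty := ⟨0, interior_subset h0⟩
  have hpos := supportFun_pos hK h0 hu
  have hpos' := supportFun_pos hK h0 (neg_ne_zero.2 hu)
  have hle := hcent.supportFun_le hK hne u
  have hle' := hcent.supportFun_le hK hne (-u)
  rw [neg_neg] at hle'
  nlinarith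

theorem subset_relDiameter_sub_smul [CompleteSpace E] [Nontrivial E] (hK : IsFullConvexBody K)
    (hC : IsFullConvexBody C) (hsymm : -C = C) {ρ : ℝ} (hρ : 0 ≤ ρ) (h : ρ • C ⊆ K) :
    K ⊆ (relDiameter K C - ρ) • C := by
  have hD : 0 ≤ relDiameter K C - ρ := by
    linarith [two_mul_le_relDiameter hK hC hsymm hρ h]
  rw [subset_iff_supportFun_le hK.isCompact hK.nonempty (hC.isCompact.smul _)
    hC.nonempty.smul_set (hC.convex.smul _)]
  intro u
  have hu := supportFun_mono hC.nonempty.smul_set hK.isCompact h (-u)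
  rw [supportFun_smul_set hρ, supportFun_neg_of_neg_eq hsymm] at hu
  rw [supportFun_smul_set hD]
  linarith [supportFun_add_supportFun_neg_le hK hC hsymm u]

theorem subset_neg_div_smul {V : Type*} [AddCommGroup V] [Module ℝ V] {K C : Set V}
    (hsymm : -C = C) {ρ R : ℝ} (hρ : 0 < ρ) (hin : ρ • C ⊆ K) (hout : K ⊆ R • C) :
    K ⊆ (-(R / ρ)) • K := by
  calc K ⊆ R • C := hout
    _ = (R / ρ) • ρ • C := by rw [smul_smul, div_mul_cancel₀ _ hρ.ne']
    _ = (-(R / ρ)) • ρ • C := by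
      rw [Set.neg_smul_set, ← Set.smul_set_neg, ← Set.smul_set_neg, hsymm]
    _ ⊆ (-(R / ρ)) • K := Set.smul_set_mono hin

variable [CompleteSpace E] [Nontrivial E]

theorem IsPseudoComplete.minkowskiAsymmetry_eq (hKC : IsPseudoComplete K C)
    (hK : IsFullConvexBody K) (hC : IsFullConvexBody C) (hsymm : -C = C)
    (hr : 0 < inradius K C) (hin : inradius K C • C ⊆ K) :
    minkowskiAsymmetry K = (relDiameter K C - inradius K C) / inradius K C := by
  have h2r := two_mul_le_relDiameter hK hC hsymm hr.le hin
  have hpos : 0 < (relDiameter K C - inradius K C) / inradius K C :=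
    div_pos (by linarith) hr
  have hmem : K - {0} ⊆ ((relDiameter K C - inradius K C) / inradius K C) • ({0} - K) := by
    simpa using subset_neg_div_smul hsymm hr hin
      (subset_relDiameter_sub_smul hK hC hsymm hr.le hin)
  refine le_antisymm (minkowskiAsymmetry_le hpos hmem) (le_csInf ⟨_, hpos, 0, hmem⟩ ?_)
  rintro ρ ⟨hρ, c, hc⟩
  have hcirc := circumradius_mul_add_one_le hK hC hsymm (by linarith) hρ hc
  rw [← show inradius K C + circumradius K C = relDiameter K C from hKC] at hcirc ⊢
  rw [div_le_iff₀ hr]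
  linarith

theorem IsPseudoComplete.relDiameter_eq (hKC : IsPseudoComplete K C)
    (hK : IsFullConvexBody K) (hC : IsFullConvexBody C) (hsymm : -C = C)
    (hr : 0 < inradius K C) (hin : inradius K C • C ⊆ K) :
    relDiameter K C = (minkowskiAsymmetry K + 1) * inradius K C := by
  rw [hKC.minkowskiAsymmetry_eq hK hC hsymm hr hin]
  field_simp
  ring

theorem IsPseudoComplete.isMinkowskiCentred (hKC : IsPseudoComplete K C)
    (hK : IsFullConvexBody K) (hC : IsFullConvexBody C) (hsymm : -C = C)
    (hr : 0 < inradius K C) (hin : inradius K C • C ⊆ K) : IsMinkowskiCentred K := by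
  rw [IsMinkowskiCentred, hKC.minkowskiAsymmetry_eq hK hC hsymm hr hin]
  exact subset_neg_div_smul hsymm hr hin (subset_relDiameter_sub_smul hK hC hsymm hr.le hin)

end Centring

section Touching

/-- The touching normals of a Minkowski centred body `K` of asymmetry `s`: the outer normals of the
hyperplanes supporting both `K` and `-s K`, normalised so that `-1 ≤ ⟨b, x⟩ ≤ s` for `x ∈ K`, with
both bounds attained. -/
def touchingNormals (K : Set E) : Set E :=
  {b | supportFun K (-b) = 1 ∧ supportFun K b = minkowskiAsymmetry K}

theorem isCompact_setOf_supportFun_neg_eq_one [FiniteDimensional ℝ E] (hK : IsCompact K)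
    (h0 : 0 ∈ interior K) : IsCompact {b | supportFun K (-b) = 1} := by
  obtain ⟨ρ, -, hρ⟩ := exists_pos_norm_le_mul_supportFun hK h0
  have hclosed : IsClosed {b | supportFun K (-b) = 1} :=
    isClosed_eq ((continuous_supportFun hK).comp continuous_neg) continuous_const
  refine (isCompact_closedBall (0 : E) ρ).of_isClosed_subset hclosed fun b hb => ?_
  have := hρ (-b)
  rwa [show supportFun K (-b) = 1 from hb, norm_neg, mul_one, ← mem_closedBall_zero_iff] at this

theorem isCompact_touchingNormals [FiniteDimensional ℝ E] (hK : IsCompact K)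
    (h0 : 0 ∈ interior K) : IsCompact (touchingNormals K) :=
  (isCompact_setOf_supportFun_neg_eq_one hK h0).inter_right
    (isClosed_eq (continuous_supportFun hK) continuous_const)

theorem sub_singleton_subset_smul_of_normalized [CompleteSpace E] (hK : IsCompact K)
    (hconv : Convex ℝ K) (h0 : 0 ∈ interior K) {ρ : ℝ} (hρ : 0 ≤ ρ) {c : E}
    (h : ∀ b, supportFun K (-b) = 1 → supportFun K b - inner ℝ b c ≤ ρ * (inner ℝ b c + 1)) :
    K - {c} ⊆ ρ • ({c} - K) := by
  rw [sub_singleton_subset_smul_iff hK ⟨0, interior_subset h0⟩ hconv hρ]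
  intro u
  rcases eq_or_ne u 0 with rfl | hu
  · simp only [neg_zero, supportFun_zero, inner_zero_left, sub_zero, add_zero, mul_zero, le_refl]
  · set m := supportFun K (-u)
    have hm0 : 0 < m := supportFun_pos hK h0 (neg_ne_zero.2 hu)
    have hscale := h (m⁻¹ • u) <| by
      rw [← smul_neg, supportFun_smul (inv_pos.2 hm0).le, inv_mul_cancel₀ hm0.ne']
    rw [supportFun_smul (inv_pos.2 hm0).le, real_inner_smul_left] at hscale
    calc supportFun K u - inner ℝ u c = m * (m⁻¹ * supportFun K u - m⁻¹ * inner ℝ u c) := by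
          field_simp
      _ ≤ m * (ρ * (m⁻¹ * inner ℝ u c + 1)) := by gcongr
      _ = ρ * (inner ℝ u c + m) := by field_simp

theorem zero_mem_convexHull_touchingNormals [FiniteDimensional ℝ E] (hK : IsCompact K)
    (hconv : Convex ℝ K) (h0 : 0 ∈ interior K) (hcent : IsMinkowskiCentred K)
    (hs0 : 0 < minkowskiAsymmetry K) : 0 ∈ convexHull ℝ (touchingNormals K) := by
  by_contra hnot
  set s := minkowskiAsymmetry K
  set S : Set E := {b | supportFun K (-b) = 1}
  have hS : IsCompact S := isCompact_setOf_supportFun_neg_eq_one hK h0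
  have hcont := continuous_supportFun hK
  obtain ⟨f, a, hf0, hfa⟩ := geometric_hahn_banach_point_closed (convex_convexHull ℝ _)
    (isCompact_convexHull (isCompact_touchingNormals hK h0)).isClosed hnot
  set c := (InnerProductSpace.toDual ℝ E).symm f
  have hc : ∀ b ∈ touchingNormals K, 0 < inner ℝ b c := fun b hb => by
    rw [real_inner_comm, InnerProductSpace.toDual_symm_apply, ← map_zero f]
    exact hf0.trans (hfa b (subset_convexHull ℝ _ hb))
  -- Moving the centre from `0` to `ε c` makes every constraint on the factor `s` strict.
  obtain ⟨ε, -, hεS⟩ : ∃ ε > 0, ∀ b ∈ S,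
      0 < (s * supportFun K (-b) - supportFun K b) + ε * ((s + 1) * inner ℝ b c) := by
    refine exists_pos_forall_add_mul_pos hS (by fun_prop) (by fun_prop)
      (fun b => sub_nonneg.2 (hcent.supportFun_le hK ⟨0, interior_subset h0⟩ b))
      fun b hb hzero => mul_pos (by linarith) (hc b ⟨hb, ?_⟩)
    rw [show supportFun K (-b) = 1 from hb] at hzero
    linarith
  have near_s : ∀ᶠ ρ in nhds s, ∀ b ∈ S,
      supportFun K b - inner ℝ b (ε • c) < ρ * (inner ℝ b (ε • c) + 1) := by
    refine hS.eventually_forall_of_forall_eventually fun b hb => ?_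
    refine (Continuous.tendsto (by fun_prop) (s, b)).eventually_lt
      (Continuous.tendsto (by fun_prop) (s, b)) ?_
    have := hεS b hb
    rw [show supportFun K (-b) = 1 from hb] at this
    rw [real_inner_smul_right]
    linarith
  obtain ⟨ρ, hρS, hρ0, hρs⟩ :=
    ((near_s.filter_mono nhdsWithin_le_nhds).and (Ioo_mem_nhdsLT hs0)).exists
  exact hρs.not_ge <| minkowskiAsymmetry_le hρ0 <|
    sub_singleton_subset_smul_of_normalized hK hconv h0 hρ0.le fun b hb => (hρS b hb).le

theorem neg_one_le_inner_of_mem_touchingNormals (hK : IsCompact K) {b x : E}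
    (hb : b ∈ touchingNormals K) (hx : x ∈ K) : -1 ≤ inner ℝ b x := by
  have h := inner_le_supportFun hK (-b) hx
  rw [hb.1, inner_neg_left] at h
  linarith

theorem weight_mul_add_one_le (hK : IsCompact K) (hne : K.Nonempty) {ι : Type*} [Fintype ι]
    {b : ι → E} {w : ι → ℝ} (hb : ∀ i, b i ∈ touchingNormals K) (hw : ∀ i, 0 < w i)
    (hw1 : ∑ i, w i = 1) (hwb : ∑ i, w i • b i = 0) (i : ι) :
    w i * (minkowskiAsymmetry K + 1) ≤ 1 := by
  obtain ⟨p, hp, hbp⟩ := exists_inner_eq_supportFun hK hne (b i)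
  have hsum : ∑ j, w j * inner ℝ (b j) p = 0 := by
    simpa only [sum_inner, real_inner_smul_left, inner_zero_left] using
      congrArg (fun v => inner ℝ v p) hwb
  calc w i * (minkowskiAsymmetry K + 1) = w i * (inner ℝ (b i) p + 1) := by rw [hbp, (hb i).2]
    _ ≤ ∑ j, w j * (inner ℝ (b j) p + 1) :=
      Finset.single_le_sum (f := fun j => w j * (inner ℝ (b j) p + 1))
        (fun j _ => mul_nonneg (hw j).le
          (by linarith [neg_one_le_inner_of_mem_touchingNormals hK (hb j) hp]))
        (Finset.mem_univ i)
    _ = 1 := by simp only [mul_add, mul_one, Finset.sum_add_distrib, hsum, hw1, zero_add]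

theorem exists_touching_triangle [FiniteDimensional ℝ E] (hdim : Module.finrank ℝ E ≤ 2)
    (hK : IsCompact K) (hconv : Convex ℝ K) (h0 : 0 ∈ interior K) (hcent : IsMinkowskiCentred K)
    (hs : 1 < minkowskiAsymmetry K) :
    ∃ (b : Fin 3 → E) (w : Fin 3 → ℝ), (∀ i, b i ∈ touchingNormals K) ∧ (∀ i, 0 < w i) ∧
      ∑ i, w i = 1 ∧ ∑ i, w i • b i = 0 ∧ Submodule.span ℝ (Set.range b) = ⊤ := by
  obtain ⟨ι, _, b, w, hb, hind, hw, hw1, hwb⟩ := eq_pos_convex_span_of_mem_convexHull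
    (zero_mem_convexHull_touchingNormals hK hconv h0 hcent (by linarith))
  have hle := weight_mul_add_one_le hK ⟨0, interior_subset h0⟩ (fun i => hb ⟨i, rfl⟩) hw hw1 hwb
  have hlower : minkowskiAsymmetry K + 1 ≤ Fintype.card ι :=
    calc minkowskiAsymmetry K + 1 = ∑ i, w i * (minkowskiAsymmetry K + 1) := by
          rw [← Finset.sum_mul, hw1, one_mul]
      _ ≤ ∑ _i : ι, 1 := Finset.sum_le_sum fun i _ => hle i
      _ = Fintype.card ι := by simp
  have hupper : Fintype.card ι ≤ Module.finrank ℝ E + 1 :=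
    hind.card_le_finrank_succ.trans (Nat.succ_le_succ (Submodule.finrank_le _))
  have hcard3 : 2 < Fintype.card ι := by
    have : (2 : ℝ) < Fintype.card ι := by linarith
    exact_mod_cast this
  have hspan : Submodule.span ℝ (Set.range b) = ⊤ := by
    have htop := (hind.affineSpan_eq_top_iff_card_eq_finrank_add_one).2 (by omega)
    rw [eq_top_iff]
    intro v _
    exact affineSpan_subset_span (htop ▸ AffineSubspace.mem_top ℝ E v)
  let e : Fin 3 ≃ ι := (Fintype.equivFinOfCardEq (by omega)).symm
  refine ⟨b ∘ e, w ∘ e, fun i => hb ⟨e i, rfl⟩, fun i => hw (e i), ?_, ?_, ?_⟩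
  · exact (Equiv.sum_comp e w).trans hw1
  · exact (Equiv.sum_comp e fun i => w i • b i).trans hwb
  · rw [e.surjective.range_comp, hspan]

theorem mul_inner_le_sub_mul_inner {b₁ b₂ b₃ p : E} {l₁ l₂ l₃ : ℝ}
    (hb : l₁ • b₁ + l₂ • b₂ + l₃ • b₃ = 0) (hl₃ : 0 ≤ l₃) (hp : -1 ≤ inner ℝ b₃ p) :
    l₂ * inner ℝ b₂ p ≤ l₃ - inner ℝ b₁ p * l₁ := by
  have hsum : l₁ * inner ℝ b₁ p + l₂ * inner ℝ b₂ p + l₃ * inner ℝ b₃ p = 0 := by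
    simpa only [inner_add_left, real_inner_smul_left, inner_zero_left] using
      congrArg (fun v => inner ℝ v p) hb
  linarith [mul_le_mul_of_nonneg_left hp hl₃]

theorem sq_sub_one_mul_inner_le_of_triangle (hK : IsCompact K) (hne : K.Nonempty)
    (hs : 1 ≤ minkowskiAsymmetry K) {b : Fin 3 → E} {w : Fin 3 → ℝ}
    (hb : ∀ i, b i ∈ touchingNormals K) (hw : ∀ i, 0 < w i) (hw1 : ∑ i, w i = 1)
    (hwb : ∑ i, w i • b i = 0) {α β : ℝ} (hα : 0 ≤ α) (hβ : 0 ≤ β)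
    (hu : u = α • b 2 - β • b 0) {x : E} (hx : x ∈ K) (hx' : -x ∈ K) :
    (minkowskiAsymmetry K ^ 2 - 1) * inner ℝ u x ≤
      minkowskiAsymmetry K * max (supportFun K u) (supportFun K (-u)) := by
  set s := minkowskiAsymmetry K
  have hbK : ∀ i, ∀ y ∈ K, -1 ≤ inner ℝ (b i) y := fun i y hy =>
    neg_one_le_inner_of_mem_touchingNormals hK (hb i) hy
  have hws := weight_mul_add_one_le hK hne hb hw hw1 hwb
  choose p hp hpb using fun i => exists_inner_eq_supportFun hK hne (b i)
  have hbp : ∀ i, inner ℝ (b i) (p i) = s := fun i => (hpb i).trans (hb i).2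
  have hux : ∀ y, inner ℝ u y = α * inner ℝ (b 2) y - β * inner ℝ (b 0) y := fun y => by
    rw [hu, inner_sub_left, real_inner_smul_left, real_inner_smul_left]
  have hM₁ := (inner_le_supportFun hK u (hp 2)).trans (le_max_left _ (supportFun K (-u)))
  have hM₂ := (inner_le_supportFun hK (-u) (hp 0)).trans (le_max_right (supportFun K u) _)
  rw [hux, hbp] at hM₁
  rw [inner_neg_left, hux, hbp, neg_sub] at hM₂
  rw [Fin.sum_univ_three] at hw1 hwb
  have hP₁₂ : w 0 * inner ℝ (b 0) (p 2) ≤ w 1 - s * w 2 := by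
    rw [← hbp 2]
    exact mul_inner_le_sub_mul_inner (by rw [← hwb]; abel) (hw 1).le (hbK 1 _ (hp 2))
  have hP₂₁ : w 2 * inner ℝ (b 2) (p 0) ≤ w 1 - s * w 0 := by
    rw [← hbp 0]
    exact mul_inner_le_sub_mul_inner (by rw [← hwb]; abel) (hw 1).le (hbK 1 _ (hp 0))
  have hαβ : inner ℝ u x ≤ α + β := by
    have h₂ := hbK 2 _ hx'
    rw [inner_neg_right] at h₂
    rw [hux]
    linarith [mul_le_mul_of_nonneg_left h₂ hα, mul_le_mul_of_nonneg_left (hbK 0 _ hx) hβ]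
  calc (s ^ 2 - 1) * inner ℝ u x ≤ (s ^ 2 - 1) * (α + β) := by gcongr; nlinarith
    _ = (α + β) * (s ^ 2 - 1) := mul_comm _ _
    _ ≤ s * max (supportFun K u) (supportFun K (-u)) :=
      add_mul_sq_sub_one_le hs (hw 2) (hw 0) (hw 1) (by linarith [hws 2]) (by linarith [hws 0])
        (by linarith [hws 1]) hP₁₂ hP₂₁ hα hβ hM₁ hM₂

theorem sq_sub_one_mul_inner_le [FiniteDimensional ℝ E] (hdim : Module.finrank ℝ E ≤ 2)
    (hK : IsCompact K) (hconv : Convex ℝ K) (h0 : 0 ∈ interior K) (hcent : IsMinkowskiCentred K)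
    (hs : 1 < minkowskiAsymmetry K) (u : E) {x : E} (hx : x ∈ K) (hx' : -x ∈ K) :
    (minkowskiAsymmetry K ^ 2 - 1) * inner ℝ u x ≤
      minkowskiAsymmetry K * max (supportFun K u) (supportFun K (-u)) := by
  obtain ⟨b, w, hb, hw, hw1, hwb, hspan⟩ := exists_touching_triangle hdim hK hconv h0 hcent hs
  have hu : u ∈ Submodule.span ℝ (Set.range b) := hspan ▸ Submodule.mem_top
  obtain ⟨μ, rfl⟩ := (Submodule.mem_span_range_iff_exists_fun ℝ).1 hu
  obtain ⟨σ, α, β, hα, hβ, hμ⟩ := exists_perm_sum_smul_eq_sub hw hwb μ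
  exact sq_sub_one_mul_inner_le_of_triangle hK ⟨0, interior_subset h0⟩ hs.le
    (fun i => hb (σ i)) (fun i => hw (σ i)) ((Equiv.sum_comp σ w).trans hw1)
    ((Equiv.sum_comp σ fun i => w i • b i).trans hwb) hα hβ hμ hx hx'

end Touching

section Ratio

theorem zero_mem_interior_of_smul_subset (hC : IsFullConvexBody C) (hsymm : -C = C) {ρ : ℝ}
    (hρ : ρ ≠ 0) (h : ρ • C ⊆ K) : 0 ∈ interior K :=
  interior_mono h <| by
    rw [interior_smul₀ hρ]
    exact ⟨0, hC.zero_mem_interior hsymm, smul_zero ρ⟩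

variable [Nontrivial E]

theorem two_mul_le_relWidth (hK : IsFullConvexBody K) (hC : IsFullConvexBody C)
    (hsymm : -C = C) {ρ : ℝ} (hρ : 0 ≤ ρ) (h : ρ • C ⊆ K) : 2 * ρ ≤ relWidth K C :=
  le_relWidth fun _ hu => two_mul_le_breadth hK hC hsymm hu hρ h

theorem IsPseudoComplete.ratio_le_half_add_one [CompleteSpace E] (hKC : IsPseudoComplete K C)
    (hK : IsFullConvexBody K) (hC : IsFullConvexBody C) (hsymm : -C = C)
    (hr : 0 < inradius K C) (hin : inradius K C • C ⊆ K) :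
    relDiameter K C / relWidth K C ≤ (minkowskiAsymmetry K + 1) / 2 := by
  have hs : 0 ≤ minkowskiAsymmetry K := Real.sInf_nonneg fun _ hx => hx.1.le
  have hw := two_mul_le_relWidth hK hC hsymm hr.le hin
  rw [div_le_iff₀ (by linarith), hKC.relDiameter_eq hK hC hsymm hr hin]
  calc (minkowskiAsymmetry K + 1) * inradius K C
      = (minkowskiAsymmetry K + 1) / 2 * (2 * inradius K C) := by ring
    _ ≤ (minkowskiAsymmetry K + 1) / 2 * relWidth K C := by gcongr

theorem IsPseudoComplete.relDiameter_mul_le_breadth [FiniteDimensional ℝ E]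
    (hdim : Module.finrank ℝ E ≤ 2) (hKC : IsPseudoComplete K C)
    (hK : IsFullConvexBody K) (hC : IsFullConvexBody C) (hsymm : -C = C)
    (hr : 0 < inradius K C) (hin : inradius K C • C ⊆ K) (hs : 1 < minkowskiAsymmetry K)
    {u : E} (hu : u ≠ 0) :
    relDiameter K C * (minkowskiAsymmetry K ^ 2 - 1) ≤
      minkowskiAsymmetry K ^ 2 * breadth u K C := by
  have h0 := zero_mem_interior_of_smul_subset hC hsymm hr.ne' hin
  have hcent := hKC.isMinkowskiCentred hK hC hsymm hr hin
  rw [hKC.relDiameter_eq hK hC hsymm hr hin]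
  set s := minkowskiAsymmetry K
  set r := inradius K C
  obtain ⟨x, hx, hux⟩ := exists_inner_eq_supportFun hC.isCompact hC.nonempty u
  have hxneg : -x ∈ C := by rwa [← Set.mem_neg, hsymm]
  have hplanar : (s ^ 2 - 1) * (r * supportFun C u) ≤
      s * max (supportFun K u) (supportFun K (-u)) := by
    rw [← hux, ← real_inner_smul_right]
    exact sq_sub_one_mul_inner_le hdim hK.isCompact hK.convex h0 hcent hs u (hin ⟨x, hx, rfl⟩)
      (hin ⟨-x, hxneg, smul_neg r x⟩)
  have hmax : (s + 1) * max (supportFun K u) (supportFun K (-u)) ≤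
      s * (supportFun K u + supportFun K (-u)) := by
    have h₁ := hcent.supportFun_le hK.isCompact hK.nonempty u
    have h₂ := hcent.supportFun_le hK.isCompact hK.nonempty (-u)
    rw [neg_neg] at h₂
    rcases max_cases (supportFun K u) (supportFun K (-u)) with ⟨h, -⟩ | ⟨h, -⟩ <;>
      rw [h] <;> linarith
  refine le_of_mul_le_mul_right ?_
    (supportFun_pos hC.isCompact (hC.zero_mem_interior hsymm) hu)
  calc (s + 1) * r * (s ^ 2 - 1) * supportFun C u
      = (s + 1) * ((s ^ 2 - 1) * (r * supportFun C u)) := by ring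
    _ ≤ (s + 1) * (s * max (supportFun K u) (supportFun K (-u))) := by gcongr
    _ = s * ((s + 1) * max (supportFun K u) (supportFun K (-u))) := by ring
    _ ≤ s * (s * (supportFun K u + supportFun K (-u))) := by gcongr
    _ = s ^ 2 * breadth u K C * supportFun C u := by
      rw [← breadth_mul_supportFun hK hC hsymm hu]
      ring

theorem IsPseudoComplete.ratio_le_sq_div [FiniteDimensional ℝ E]
    (hdim : Module.finrank ℝ E ≤ 2) (hKC : IsPseudoComplete K C)
    (hK : IsFullConvexBody K) (hC : IsFullConvexBody C) (hsymm : -C = C)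
    (hr : 0 < inradius K C) (hin : inradius K C • C ⊆ K) (hs : 1 < minkowskiAsymmetry K) :
    relDiameter K C / relWidth K C ≤
      minkowskiAsymmetry K ^ 2 / (minkowskiAsymmetry K ^ 2 - 1) := by
  set s := minkowskiAsymmetry K
  have hs2 : 0 < s ^ 2 - 1 := by nlinarith
  have hw : relDiameter K C * (s ^ 2 - 1) / s ^ 2 ≤ relWidth K C :=
    le_relWidth fun u hu => (div_le_iff₀' (by positivity)).2
      (hKC.relDiameter_mul_le_breadth hdim hK hC hsymm hr hin hs hu)
  have hw0 : 0 < relWidth K C := by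
    linarith [two_mul_le_relWidth hK hC hsymm hr.le hin]
  rw [div_le_div_iff₀ hw0 hs2]
  exact (div_le_iff₀' (by positivity)).1 hw

theorem IsPseudoComplete.ratio_le_of_inradius_smul_subset [FiniteDimensional ℝ E]
    (hdim : Module.finrank ℝ E ≤ 2) (hKC : IsPseudoComplete K C)
    (hK : IsFullConvexBody K) (hC : IsFullConvexBody C) (hsymm : -C = C)
    (hr : 0 < inradius K C) (hin : inradius K C • C ⊆ K) :
    relDiameter K C / relWidth K C ≤ (minkowskiAsymmetry K + 1) / 2 ∧
    (minkowskiAsymmetry K ≠ 1 →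
      relDiameter K C / relWidth K C
        ≤ min ((minkowskiAsymmetry K + 1) / 2)
            (minkowskiAsymmetry K ^ 2 / (minkowskiAsymmetry K ^ 2 - 1))) ∧
    relDiameter K C / relWidth K C ≤ ratioBound := by
  have hs : 1 ≤ minkowskiAsymmetry K :=
    (hKC.isMinkowskiCentred hK hC hsymm hr hin).one_le hK.isCompact
      (zero_mem_interior_of_smul_subset hC hsymm hr.ne' hin)
  have hhalf := hKC.ratio_le_half_add_one hK hC hsymm hr hin
  have hsq (hs1 : minkowskiAsymmetry K ≠ 1) :=
    hKC.ratio_le_sq_div hdim hK hC hsymm hr hin (hs.lt_of_ne' hs1)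
  exact ⟨hhalf, fun hs1 => le_min hhalf (hsq hs1), le_ratioBound hs hhalf hsq⟩

end Ratio

theorem theorem1p4_general [Nontrivial E] (hdim : Module.finrank ℝ E ≤ 2)
    (hK : IsFullConvexBody K) (hC : IsFullConvexBody C) (hCsymm : -C = C)
    (hKC : IsPseudoComplete K C) :
    relDiameter K C / relWidth K C ≤ (minkowskiAsymmetry K + 1) / 2 ∧
    (minkowskiAsymmetry K ≠ 1 →
      relDiameter K C / relWidth K C
        ≤ min ((minkowskiAsymmetry K + 1) / 2)
            (minkowskiAsymmetry K ^ 2 / (minkowskiAsymmetry K ^ 2 - 1))) ∧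
    relDiameter K C / relWidth K C ≤ ratioBound := by
  have := hK.finiteDimensional
  obtain ⟨⟨hr, t, hin⟩, -⟩ := isGreatest_inradius hK hC hCsymm
  rw [← isPseudoComplete_add_singleton_iff t] at hKC
  rw [← inradius_add_singleton K C t] at hr hin
  simpa only [relDiameter_add_singleton, relWidth_add_singleton, minkowskiAsymmetry_add_singleton]
    using hKC.ratio_le_of_inradius_smul_subset hdim (hK.add_singleton t) hC hCsymm hr hin

/-- For `s(K) = 1` the term `s(K)² / (s(K)² - 1)` is `+∞`, so only `(s(K) + 1) / 2` remains in the
minimum. The last two parts identify the absolute bound: it is about `1.42`, and it is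
`(s + 1) / 2` for the unique `s > 1` at which the two terms of the minimum agree. -/
theorem theorem1p4 (K C : Set (EuclideanSpace ℝ (Fin 2)))
    (hK : IsFullConvexBody K) (hC : IsFullConvexBody C) (hCsymm : -C = C)
    (hKC : IsPseudoComplete K C) :
    relDiameter K C / relWidth K C ≤ (minkowskiAsymmetry K + 1) / 2 ∧
    (minkowskiAsymmetry K ≠ 1 →
      relDiameter K C / relWidth K C
        ≤ min ((minkowskiAsymmetry K + 1) / 2)
            (minkowskiAsymmetry K ^ 2 / (minkowskiAsymmetry K ^ 2 - 1))) ∧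
    relDiameter K C / relWidth K C ≤ ratioBound ∧
    |ratioBound - 1.42| < 0.005 ∧
    (∀ s : ℝ, 1 < s → ((s + 1) / 2 = s ^ 2 / (s ^ 2 - 1) ↔ ratioBound = (s + 1) / 2)) := by
  obtain ⟨hhalf, hmin, hβ⟩ := theorem1p4_general (by simp) hK hC hCsymm hKC
  exact ⟨hhalf, hmin, hβ, abs_ratioBound_sub_lt, fun _ => half_add_one_eq_sq_div_iff⟩
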